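/- All graphs are finite and simple. For a graph \(G\) with vertex set \(V\) and edge set \(E\), let \(\mathcal{P}_G\subset\mathbb{R}^V\) be its edge polytope, i.e. the convex hull of the vectors \(\mathbf{e}_v+\mathbf{e}_w\) for all edges \(\{v,w\}\in E\). Let \(i_G(0)=1\) and \(i_G(m)=|m\mathcal{P}_G\cap\mathbb{Z}^V|\) for \(m\ge 1\), and let \(H_G(t)=\sum_{m\ge 0} i_G(m)\,t^m\) be the Ehrhart series of \(\mathcal{P}_G\), a formal power series. **Theorem (Second Factoring Property).** Let \(G\) be a connected graph, and let \(G^{(1)}\) and \(G^{(2)}\) be subgraphs of \(G\). Assume that 1. every edge of \(G\) belongs to \(G^{(1)}\) or to \(G^{(2)}\), exactly one edge \(e\) belongs to both, and every vertex that belongs to both \(G^{(1)}\) and \(G^{(2)}\) is an end vertex of \(e\); 2. \(G^{(2)}\) is bipartite; and 3. \(e\) lies on a cycle of \(G^{(2)}\). Then \[H_G(t)=H_{G^{(1)}}(t)\,\bigl(H_{G^{(2)}}(t)\,(1-t)\bigr).\] -/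

import Mathlib

open scoped Pointwise

namespace SimpleGraph

/-- The vector `ρ(e) = 𝐞_v + 𝐞_w` in `ℝ^V` of an edge `e = {v, w}` (with `v ≠ w`):
the indicator function of the set of end vertices of `e`. -/
noncomputable def edgeVector {V : Type*} (e : Sym2 V) : V → ℝ :=
  Set.indicator {v | v ∈ e} 1

/-- The edge polytope of `G`: the convex hull in `ℝ^V` of the vectors `ρ(e)`, for `e` an edge. -/
noncomputable def edgePolytope {V : Type*} (G : SimpleGraph V) : Set (V → ℝ) :=
  convexHull ℝ (edgeVector '' G.edgeSet)

/-- The integral points of the `m`-th dilation of the edge polytope of `G`. -/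
def dilatedLatticePoints {V : Type*} (G : SimpleGraph V) (m : ℕ) : Set (V → ℤ) :=
  {x | (fun v => (x v : ℝ)) ∈ (m : ℝ) • G.edgePolytope}

/-- The counting function `i_G(m)` of the integral points of the dilated edge polytopes,
with the convention `i_G(0) = 1`. (For finite `V` the set that is counted is finite.) -/
noncomputable def ehrhartCount {V : Type*} (G : SimpleGraph V) (m : ℕ) : ℕ :=
  if m = 0 then 1 else (G.dilatedLatticePoints m).ncard

/-- The Ehrhart series `H_G(t) = ∑ i_G(m) t^m`, a formal power series. -/
noncomputable def ehrhartSeries {V : Type*} (G : SimpleGraph V) : PowerSeries ℤ :=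
  PowerSeries.mk fun m => (G.ehrhartCount m : ℤ)

end SimpleGraph

/-! The edge polytope lies in the hyperplane of coordinate sum 2, so `i_G(m)` counts the integral
points of degree `m` (coordinate sum `2 * m`) in the cone generated by the edge vectors. Call an
integral point `y` of the cone of `G₂` reduced if `y - ρ(e)` leaves that cone. Multiplying the
series of `G₂` by `1 - t` counts reduced points, so it suffices that each integral point of the cone
of `G` is uniquely `x + y`, with `x` integral in the cone of `G₁` and `y` reduced.

Existence (`IsSide.exists_reduced_add`): in a real decomposition, `y` is integral away from the ends
of `e`. Since `G₂` is bipartite, `y` has equal sums on both sides, so its two remaining fractional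
parts agree and form a multiple of `ρ(e)`, which is moved to `x`. The floor of `y` stays in the cone
by a Hall argument (`IsSide.floor_mem_coneLatticePoints`). Then copies of `ρ(e)` are moved to `x`
until `y` is reduced.

Uniqueness (`IsSide.reduced_add_unique`): two candidates for `y` differ by an integer multiple of
`ρ(e)`, and reducedness makes it zero. -/

namespace SimpleGraph

open Finset

/-! ### Cones over edge vectors and dilated edge polytopes. -/

section EdgeCone

variable {V : Type*}

/-- The cone in `ℝ^V` generated by the vectors of a set of edges. -/
noncomputable def edgeCone (E : Set (Sym2 V)) : Submodule NNReal (V → ℝ) :=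
  Submodule.span NNReal (edgeVector '' E)

/-- The integral points of the cone generated by the vectors of a set of edges. -/
def coneLatticePoints (E : Set (Sym2 V)) : Set (V → ℤ) :=
  {x | (fun v => (x v : ℝ)) ∈ edgeCone E}

/-- The integral version of `edgeVector`. -/
noncomputable def intEdgeVector (e : Sym2 V) : V → ℤ :=
  Set.indicator {v | v ∈ e} 1

theorem intEdgeVector_cast (e : Sym2 V) :
    (fun v => (intEdgeVector e v : ℝ)) = edgeVector e := by
  classical
  funext v
  simp only [intEdgeVector, edgeVector, Set.indicator_apply]
  split_ifs <;> simp

theorem edgeVector_mem_edgeCone {E : Set (Sym2 V)} {e : Sym2 V} (he : e ∈ E) :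
    edgeVector e ∈ edgeCone E :=
  Submodule.subset_span ⟨e, he, rfl⟩

theorem smul_edgeVector_mem_edgeCone {E : Set (Sym2 V)} {e : Sym2 V} (he : e ∈ E)
    {t : ℝ} (ht : 0 ≤ t) : t • edgeVector e ∈ edgeCone E :=
  (edgeCone E).smul_mem ⟨t, ht⟩ (edgeVector_mem_edgeCone he)

theorem edgeVector_apply_of_mem {e : Sym2 V} {v : V} (h : v ∈ e) : edgeVector e v = 1 := by
  simp [edgeVector, h]

theorem edgeVector_apply_of_notMem {e : Sym2 V} {v : V} (h : v ∉ e) : edgeVector e v = 0 := by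
  simp [edgeVector, h]

theorem intEdgeVector_apply_of_mem {e : Sym2 V} {v : V} (h : v ∈ e) : intEdgeVector e v = 1 := by
  simp [intEdgeVector, h]

theorem intEdgeVector_apply_of_notMem {e : Sym2 V} {v : V} (h : v ∉ e) :
    intEdgeVector e v = 0 := by
  simp [intEdgeVector, h]

theorem zero_mem_coneLatticePoints (E : Set (Sym2 V)) : 0 ∈ coneLatticePoints E := by
  have : (fun v : V => (((0 : V → ℤ) v : ℤ) : ℝ)) = 0 := by funext v; simp
  simp only [coneLatticePoints, Set.mem_ofPred_eq, this]
  exact zero_mem _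

theorem add_mem_coneLatticePoints {E : Set (Sym2 V)} {x y : V → ℤ}
    (hx : x ∈ coneLatticePoints E) (hy : y ∈ coneLatticePoints E) :
    x + y ∈ coneLatticePoints E := by
  have : (fun v : V => (((x + y) v : ℤ) : ℝ)) = (fun v => (x v : ℝ)) + fun v => (y v : ℝ) := by
    funext v; simp
  simp only [coneLatticePoints, Set.mem_ofPred_eq, this]
  exact add_mem hx hy

theorem intEdgeVector_mem_coneLatticePoints {E : Set (Sym2 V)} {e : Sym2 V} (he : e ∈ E) :
    intEdgeVector e ∈ coneLatticePoints E := by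
  simp only [coneLatticePoints, Set.mem_ofPred_eq, intEdgeVector_cast]
  exact edgeVector_mem_edgeCone he

theorem nsmul_intEdgeVector_mem_coneLatticePoints {E : Set (Sym2 V)} {e : Sym2 V} (he : e ∈ E)
    (n : ℕ) : n • intEdgeVector e ∈ coneLatticePoints E := by
  induction n with
  | zero => simpa using zero_mem_coneLatticePoints E
  | succ n ih =>
    rw [succ_nsmul]
    exact add_mem_coneLatticePoints ih (intEdgeVector_mem_coneLatticePoints he)

theorem coneLatticePoints_mono {E F : Set (Sym2 V)} (h : E ⊆ F) :
    coneLatticePoints E ⊆ coneLatticePoints F :=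
  fun _ hx => Submodule.span_mono (Set.image_mono h) hx

theorem apply_eq_zero_of_mem_edgeCone {E : Set (Sym2 V)} {x : V → ℝ} (hx : x ∈ edgeCone E)
    {v : V} (hv : ∀ f ∈ E, v ∉ f) : x v = 0 := by
  induction hx using Submodule.span_induction with
  | mem x h =>
    obtain ⟨f, hf, rfl⟩ := h
    exact edgeVector_apply_of_notMem (hv f hf)
  | zero => rfl
  | add x y _ _ h₁ h₂ => simp [h₁, h₂]
  | smul c x _ h => simp [h]

theorem nonneg_of_mem_edgeCone {E : Set (Sym2 V)} {x : V → ℝ} (hx : x ∈ edgeCone E) (v : V) :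
    0 ≤ x v := by
  induction hx using Submodule.span_induction with
  | mem x h =>
    obtain ⟨f, hf, rfl⟩ := h
    exact Set.indicator_nonneg (fun _ _ => zero_le_one) v
  | zero => simp
  | add x y _ _ h₁ h₂ => exact add_nonneg h₁ h₂
  | smul r x _ h => exact mul_nonneg r.2 h

theorem nonneg_of_mem_coneLatticePoints {E : Set (Sym2 V)} {x : V → ℤ}
    (hx : x ∈ coneLatticePoints E) (v : V) : 0 ≤ x v := by
  exact_mod_cast nonneg_of_mem_edgeCone hx v

theorem exists_smul_of_mem_edgeCone {E : Set (Sym2 V)} (hne : E.Nonempty) {x : V → ℝ}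
    (hx : x ∈ edgeCone E) :
    ∃ c : ℝ, 0 ≤ c ∧ ∃ p ∈ convexHull ℝ (edgeVector '' E), x = c • p := by
  -- The zero vector still needs some point of the hull to be scaled by 0.
  obtain ⟨f₀, hf₀⟩ := hne
  have hp₀ := subset_convexHull ℝ _ (Set.mem_image_of_mem (edgeVector (V := V)) hf₀)
  induction hx using Submodule.span_induction with
  | mem x h => exact ⟨1, zero_le_one, x, subset_convexHull ℝ _ h, (one_smul _ _).symm⟩
  | zero => exact ⟨0, le_rfl, _, hp₀, (zero_smul _ _).symm⟩
  | add x y _ _ h₁ h₂ =>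
    obtain ⟨c, hc, p, hp, rfl⟩ := h₁
    obtain ⟨d, hd, q, hq, rfl⟩ := h₂
    rcases (add_nonneg hc hd).eq_or_lt with h | h
    · obtain rfl : c = 0 := by linarith
      obtain rfl : d = 0 := by linarith
      exact ⟨0, le_rfl, _, hp₀, by simp⟩
    · refine ⟨c + d, h.le, (c / (c + d)) • p + (d / (c + d)) • q,
        convex_convexHull ℝ _ hp hq (by positivity) (by positivity) (by field_simp), ?_⟩
      rw [smul_add, smul_smul, smul_smul, mul_div_cancel₀ _ h.ne', mul_div_cancel₀ _ h.ne']
  | smul r x _ h =>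
    obtain ⟨c, hc, p, hp, rfl⟩ := h
    exact ⟨r * c, mul_nonneg r.2 hc, p, hp, by rw [NNReal.smul_def, smul_smul]⟩

theorem convexHull_subset_edgeCone (E : Set (Sym2 V)) :
    convexHull ℝ (edgeVector '' E) ⊆ edgeCone E := by
  refine convexHull_min Submodule.subset_span ?_
  intro x hx y hy a b ha hb _
  exact add_mem ((edgeCone E).smul_mem ⟨a, ha⟩ hx) ((edgeCone E).smul_mem ⟨b, hb⟩ hy)

variable [Fintype V]

theorem sum_mul_edgeVector (c : V → ℝ) {u v : V} (h : u ≠ v) :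
    ∑ w, c w * edgeVector s(u, v) w = c u + c v := by
  classical
  have : ∀ w, c w * edgeVector s(u, v) w = if w ∈ ({u, v} : Finset V) then c w else 0 := by
    intro w
    simp [edgeVector, Set.indicator_apply]
  simp_rw [this]
  rw [Finset.sum_ite_mem, Finset.univ_inter, Finset.sum_pair h]

/-- A linear functional need only be checked on the generators. The balance and Hall inequalities
below are instances. -/
theorem sum_mul_nonneg_of_mem_edgeCone {E : Set (Sym2 V)} (hE : ∀ f ∈ E, ¬ f.IsDiag)
    {c : V → ℝ} (hc : ∀ u v, s(u, v) ∈ E → 0 ≤ c u + c v) {x : V → ℝ} (hx : x ∈ edgeCone E) :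
    0 ≤ ∑ v, c v * x v := by
  induction hx using Submodule.span_induction with
  | mem x h =>
    obtain ⟨f, hf, rfl⟩ := h
    induction f with | _ u v =>
    rw [sum_mul_edgeVector c (by simpa using hE _ hf)]
    exact hc u v hf
  | zero => simp
  | add x y _ _ h₁ h₂ =>
    simp only [Pi.add_apply, mul_add, sum_add_distrib]
    exact add_nonneg h₁ h₂
  | smul r x _ h =>
    have : ∑ v, c v * (r • x) v = r * ∑ v, c v * x v := by
      rw [mul_sum]
      exact sum_congr rfl fun v _ => by rw [Pi.smul_apply, NNReal.smul_def, smul_eq_mul]; ring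
    rw [this]
    exact mul_nonneg r.2 h

theorem sum_mul_eq_zero_of_mem_edgeCone {E : Set (Sym2 V)} (hE : ∀ f ∈ E, ¬ f.IsDiag)
    {c : V → ℝ} (hc : ∀ u v, s(u, v) ∈ E → c u + c v = 0) {x : V → ℝ} (hx : x ∈ edgeCone E) :
    ∑ v, c v * x v = 0 := by
  apply le_antisymm
  · have := sum_mul_nonneg_of_mem_edgeCone hE (c := fun v => -c v)
      (fun u v h => by linarith [hc u v h]) hx
    simpa using this
  · exact sum_mul_nonneg_of_mem_edgeCone hE (fun u v h => (hc u v h).ge) hx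

theorem sum_intEdgeVector {e : Sym2 V} (he : ¬ e.IsDiag) : ∑ v, intEdgeVector e v = 2 := by
  induction e with | _ u v =>
  have := sum_mul_edgeVector (fun _ => 1) (u := u) (v := v) (by simpa using he)
  simp only [← intEdgeVector_cast, one_mul] at this
  have h : ((∑ w, intEdgeVector s(u, v) w : ℤ) : ℝ) = ((2 : ℤ) : ℝ) := by
    push_cast
    rw [this]
    norm_num
  exact_mod_cast h

theorem sum_eq_two_of_mem_convexHull {E : Set (Sym2 V)} (hE : ∀ f ∈ E, ¬ f.IsDiag) {p : V → ℝ}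
    (hp : p ∈ convexHull ℝ (edgeVector '' E)) : ∑ v, p v = 2 := by
  have hconv : Convex ℝ {p : V → ℝ | ∑ v, p v = 2} := by
    intro x hx y hy a b _ _ hab
    simp only [Set.mem_ofPred_eq] at hx hy ⊢
    simp only [Pi.add_apply, Pi.smul_apply, smul_eq_mul, sum_add_distrib, ← mul_sum, hx, hy]
    linarith
  refine convexHull_min ?_ hconv hp
  rintro _ ⟨f, hf, rfl⟩
  induction f with | _ u v =>
  have := sum_mul_edgeVector (fun _ => 1) (u := u) (v := v) (by simpa using hE _ hf)
  simp only [one_mul] at this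
  simp only [Set.mem_ofPred_eq, this]
  norm_num

/-- The hull has constant coordinate sum 2, so the coordinate sum of a cone point fixes its scaling
factor. -/
theorem mem_smul_convexHull_iff {E : Set (Sym2 V)} (hE : ∀ f ∈ E, ¬ f.IsDiag)
    (hne : E.Nonempty) (m : ℕ) (x : V → ℝ) :
    x ∈ (m : ℝ) • convexHull ℝ (edgeVector '' E) ↔ x ∈ edgeCone E ∧ ∑ v, x v = 2 * m := by
  constructor
  · rintro ⟨p, hp, rfl⟩
    refine ⟨(edgeCone E).smul_mem (m : NNReal) (convexHull_subset_edgeCone E hp), ?_⟩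
    simp only [Pi.smul_apply, smul_eq_mul, ← mul_sum, sum_eq_two_of_mem_convexHull hE hp]
    ring
  · rintro ⟨hx, hs⟩
    obtain ⟨c, hc, p, hp, rfl⟩ := exists_smul_of_mem_edgeCone hne hx
    simp only [Pi.smul_apply, smul_eq_mul, ← mul_sum, sum_eq_two_of_mem_convexHull hE hp] at hs
    obtain rfl : c = m := by linarith
    exact ⟨p, hp, rfl⟩

end EdgeCone

/-! ### Cones of subgraphs inside the ambient space. -/

section Subgraph

variable {V : Type*}

theorem extend_edgeVector {G : SimpleGraph V} (H : G.Subgraph) (f : Sym2 H.verts) :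
    Function.extend Subtype.val (edgeVector f) 0 = edgeVector (f.map Subtype.val) := by
  classical
  funext v
  by_cases hv : v ∈ H.verts
  · have := Subtype.val_injective.extend_apply (edgeVector f) (0 : V → ℝ) (⟨v, hv⟩ : H.verts)
    simp only at this
    rw [this]
    have key : v ∈ f.map Subtype.val ↔ (⟨v, hv⟩ : H.verts) ∈ f := by
      simp [Sym2.mem_map, hv]
    by_cases h : (⟨v, hv⟩ : H.verts) ∈ f
    · rw [edgeVector_apply_of_mem h, edgeVector_apply_of_mem (key.2 h)]
    · rw [edgeVector_apply_of_notMem h, edgeVector_apply_of_notMem (mt key.1 h)]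
  · rw [Function.extend_apply' _ _ _ (by simpa using hv), edgeVector_apply_of_notMem]
    · rfl
    · rw [Sym2.mem_map]
      rintro ⟨w, _, rfl⟩
      exact hv w.2

/-- Extension by zero is linear and injective and maps generators onto generators. -/
theorem mem_edgeCone_coe_iff {G : SimpleGraph V} (H : G.Subgraph) (x : H.verts → ℝ) :
    x ∈ edgeCone H.coe.edgeSet ↔ Function.extend Subtype.val x 0 ∈ edgeCone H.edgeSet := by
  let φ : (H.verts → ℝ) →ₗ[NNReal] (V → ℝ) :=
    (Function.ExtendByZero.linearMap ℝ (Subtype.val : H.verts → V)).restrictScalars NNReal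
  have hφ : ∀ x, φ x = Function.extend Subtype.val x 0 := fun _ => rfl
  have hinj : Function.Injective φ := by
    intro x y h
    funext v
    have := congrFun h v
    rwa [hφ, hφ, Subtype.val_injective.extend_apply, Subtype.val_injective.extend_apply] at this
  have hmap : edgeCone H.edgeSet = (edgeCone H.coe.edgeSet).map φ := by
    rw [edgeCone, edgeCone, Submodule.map_span, ← H.image_coe_edgeSet_coe, Set.image_image,
      Set.image_image]
    simp_rw [hφ, extend_edgeVector]
  rw [← hφ, hmap]
  exact (hinj.mem_set_image (s := edgeCone H.coe.edgeSet)).symm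

end Subgraph

/-! ### Ehrhart counts as counts of integral cone points. -/

section LatticePoints

variable {V : Type*} [Fintype V]

/-- The integral points with coordinate sum `2 * m` of the cone generated by the vectors of a set
of edges. -/
def conePointsOfDegree (E : Set (Sym2 V)) (m : ℕ) : Set (V → ℤ) :=
  {x | x ∈ coneLatticePoints E ∧ ∑ v, x v = 2 * m}

theorem finite_conePointsOfDegree (E : Set (Sym2 V)) (m : ℕ) :
    (conePointsOfDegree E m).Finite := by
  classical
  refine (Set.finite_Icc (0 : V → ℤ) (fun _ => 2 * m)).subset fun x hx => ?_
  have h0 := nonneg_of_mem_coneLatticePoints hx.1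
  exact ⟨h0, fun v => hx.2 ▸ single_le_sum (fun w _ => h0 w) (mem_univ v)⟩

theorem conePointsOfDegree_zero (E : Set (Sym2 V)) : conePointsOfDegree E 0 = {0} := by
  ext x
  constructor
  · rintro ⟨hx, hs⟩
    have h0 := nonneg_of_mem_coneLatticePoints hx
    rw [Nat.cast_zero, mul_zero, sum_eq_zero_iff_of_nonneg fun v _ => h0 v] at hs
    exact funext fun v => hs v (mem_univ v)
  · rintro rfl
    exact ⟨zero_mem_coneLatticePoints E, by simp⟩

theorem setOf_mem_smul_convexHull {E : Set (Sym2 V)} (hE : ∀ f ∈ E, ¬ f.IsDiag)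
    (hne : E.Nonempty) (m : ℕ) :
    {x : V → ℤ | (fun v => (x v : ℝ)) ∈ (m : ℝ) • convexHull ℝ (edgeVector '' E)} =
      conePointsOfDegree E m := by
  ext x
  rw [Set.mem_ofPred_eq, mem_smul_convexHull_iff hE hne]
  refine and_congr Iff.rfl ?_
  exact_mod_cast Iff.rfl

theorem ehrhartCount_eq_ncard (G : SimpleGraph V) (hne : G.edgeSet.Nonempty) (m : ℕ) :
    G.ehrhartCount m = (conePointsOfDegree G.edgeSet m).ncard := by
  rw [ehrhartCount]
  split_ifs with h
  · subst h
    simp [conePointsOfDegree_zero]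
  · rw [← setOf_mem_smul_convexHull (fun f hf => G.not_isDiag_of_mem_edgeSet hf) hne]
    rfl

theorem ehrhartCount_coe_eq_ncard {G : SimpleGraph V} (H : G.Subgraph) (hne : H.edgeSet.Nonempty)
    (m : ℕ) : H.coe.ehrhartCount m = (conePointsOfDegree H.edgeSet m).ncard := by
  classical
  have : Fintype H.verts := Fintype.ofFinite _
  have hne' : H.coe.edgeSet.Nonempty := by
    rwa [← H.image_coe_edgeSet_coe, Set.image_nonempty] at hne
  rw [ehrhartCount_eq_ncard _ hne']
  have hcast : ∀ x : H.verts → ℤ, (fun v => ((Function.extend Subtype.val x 0 v : ℤ) : ℝ)) =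
      Function.extend Subtype.val (fun v => (x v : ℝ)) 0 := by
    intro x
    funext v
    by_cases hv : ∃ w : H.verts, w.1 = v
    · obtain ⟨w, rfl⟩ := hv
      simp
    · simp [Function.extend_apply' _ _ _ hv]
  have hsum : ∀ x : H.verts → ℤ,
      ∑ v, Function.extend Subtype.val x (0 : V → ℤ) v = ∑ v, x v := by
    intro x
    symm
    refine sum_of_injOn Subtype.val Subtype.val_injective.injOn (by simp) ?_ ?_
    · intro v _ hv
      exact Function.extend_apply' _ _ _ (by simpa using hv)
    · intro v _
      rw [Subtype.val_injective.extend_apply]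
  refine Set.ncard_congr (fun x _ => Function.extend Subtype.val x 0) ?_ ?_ ?_
  · rintro x ⟨hx, hs⟩
    refine ⟨?_, by rw [hsum, hs]⟩
    simp only [coneLatticePoints, Set.mem_ofPred_eq] at hx ⊢
    rwa [hcast, ← mem_edgeCone_coe_iff]
  · intro x y _ _ h
    funext v
    have := congrFun h v
    rwa [Subtype.val_injective.extend_apply, Subtype.val_injective.extend_apply] at this
  · rintro y ⟨hy, hs⟩
    have hext : Function.extend Subtype.val (fun v : H.verts => y v) 0 = y := by
      funext v
      by_cases hv : ∃ w : H.verts, w.1 = v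
      · obtain ⟨w, rfl⟩ := hv
        simp
      · rw [Function.extend_apply' _ _ _ hv]
        have : ((y v : ℤ) : ℝ) = 0 := by
          refine apply_eq_zero_of_mem_edgeCone (show _ ∈ edgeCone H.edgeSet from hy)
            (v := v) fun f hf hvf => hv ⟨⟨v, ?_⟩, rfl⟩
          exact H.mem_verts_of_mem_edge hf hvf
        exact_mod_cast this.symm
    refine ⟨fun v => y v, ⟨?_, by rw [← hs, ← hsum, hext]⟩, hext⟩
    simp only [coneLatticePoints, Set.mem_ofPred_eq] at hy ⊢
    rwa [mem_edgeCone_coe_iff, ← hcast, hext]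

end LatticePoints

/-! ### Bipartitions. -/

section Side

/-- The set `A` meets every edge in `E` in exactly one vertex. -/
def IsSide {V : Type*} (E : Set (Sym2 V)) (A : Finset V) : Prop :=
  ∀ u v, s(u, v) ∈ E → (u ∈ A ↔ v ∉ A)

variable {V : Type*} {E : Set (Sym2 V)} {A : Finset V}

theorem IsSide.not_isDiag (hA : IsSide E A) : ∀ f ∈ E, ¬ f.IsDiag := by
  intro f hf
  induction f with | _ u v =>
  rw [Sym2.mk_isDiag_iff]
  rintro rfl
  have := hA u u hf
  tauto

end Side

/-! ### Hall's theorem and rounding in bipartite cones. -/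

section Bipartite

variable {V : Type*} [Fintype V]

open Classical in
/-- The vertices that are joined to a vertex in `S` by an edge in `E`. -/
noncomputable def edgeNeighbors (E : Set (Sym2 V)) (S : Finset V) : Finset V :=
  {w | ∃ u ∈ S, s(u, w) ∈ E}

theorem mem_edgeNeighbors {E : Set (Sym2 V)} {S : Finset V} {w : V} :
    w ∈ edgeNeighbors E S ↔ ∃ u ∈ S, s(u, w) ∈ E := by
  simp [edgeNeighbors]

variable [DecidableEq V] {E : Set (Sym2 V)} {A : Finset V}

theorem IsSide.sum_eq_sum_compl (hA : IsSide E A) {x : V → ℝ} (hx : x ∈ edgeCone E) :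
    ∑ v ∈ A, x v = ∑ v ∈ Aᶜ, x v := by
  have h := sum_mul_eq_zero_of_mem_edgeCone hA.not_isDiag (c := fun v => if v ∈ A then 1 else -1)
    (fun u v huv => by
      have := hA u v huv
      by_cases hu : u ∈ A <;> by_cases hv : v ∈ A <;> simp_all) hx
  rw [← sum_add_sum_compl A] at h
  rw [sum_congr rfl (g := x) fun v hv => by simp [hv],
    sum_congr (s₁ := Aᶜ) rfl (g := fun v => - x v) fun v hv => by simp [mem_compl.1 hv],
    sum_neg_distrib] at h
  linarith

/-- The indicator of the neighbors minus that of `S` is nonnegative on every edge: an edge has at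
most one end in `S`, and its other end is then a neighbor. -/
theorem IsSide.sum_le_sum_edgeNeighbors (hA : IsSide E A) {x : V → ℝ} (hx : x ∈ edgeCone E)
    {S : Finset V} (hS : S ⊆ A) : ∑ v ∈ S, x v ≤ ∑ v ∈ edgeNeighbors E S, x v := by
  have h := sum_mul_nonneg_of_mem_edgeCone hA.not_isDiag
    (c := fun v => (if v ∈ edgeNeighbors E S then 1 else 0) - (if v ∈ S then 1 else 0))
    (fun u v huv => by
      have h₁ : u ∈ S → v ∈ edgeNeighbors E S := fun h => mem_edgeNeighbors.2 ⟨u, h, huv⟩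
      have h₂ : v ∈ S → u ∈ edgeNeighbors E S :=
        fun h => mem_edgeNeighbors.2 ⟨v, h, Sym2.eq_swap ▸ huv⟩
      have h₃ : ¬ (u ∈ S ∧ v ∈ S) := fun h => (hA u v huv).1 (hS h.1) (hS h.2)
      by_cases hu : u ∈ S <;> by_cases hv : v ∈ S <;> simp_all <;> split_ifs <;> norm_num) hx
  simp only [sub_mul, ite_mul, one_mul, zero_mul, sum_sub_distrib, sum_ite_mem, univ_inter] at h
  linarith

/-- A bipartite version of the transportation theorem, deduced from Hall's marriage theorem. -/
theorem IsSide.natCast_mem_edgeCone (hA : IsSide E A) (y : V → ℕ)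
    (hbal : ∑ v ∈ A, y v = ∑ v ∈ Aᶜ, y v)
    (hall : ∀ S ⊆ A, ∑ v ∈ S, y v ≤ ∑ v ∈ edgeNeighbors E S, y v) :
    (fun v => (y v : ℝ)) ∈ edgeCone E := by
  classical
  -- Each vertex `v` is replaced by `y v` copies. A perfect matching of the copies in `A` with those
  -- outside writes `y` as a sum of edge vectors.
  let X := Σ v : V, Fin (y v)
  let ι := {p : X // p.1 ∈ A}
  let κ := {p : X // p.1 ∉ A}
  have hX : ∀ S : Finset V, #{p : X | p.1 ∈ S} = ∑ v ∈ S, y v := by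
    intro S
    have : (univ.filter fun p : X => p.1 ∈ S) = S.sigma fun v => (univ : Finset (Fin (y v))) := by
      ext p
      rw [mem_sigma]
      simp
    rw [this, card_sigma]
    simp
  obtain ⟨f, hf, hr⟩ := (Fintype.all_card_le_filter_rel_iff_exists_injective
    (fun (p : ι) (q : κ) => s(p.1.1, q.1.1) ∈ E)).1 (by
      intro T
      let S : Finset V := T.image fun p => p.1.1
      have hS : S ⊆ A := by
        intro v hv
        obtain ⟨p, _, rfl⟩ := mem_image.1 hv
        exact p.2
      calc #T ≤ #{p : X | p.1 ∈ S} :=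
            card_le_card_of_injOn Subtype.val
              (fun p hp => by
                rw [coe_filter]
                exact ⟨mem_univ _, mem_image_of_mem (fun p : ι => p.1.1) hp⟩)
              Subtype.val_injective.injOn
        _ = ∑ v ∈ S, y v := hX S
        _ ≤ ∑ v ∈ edgeNeighbors E S, y v := hall S hS
        _ = #{p : X | p.1 ∈ edgeNeighbors E S} := (hX _).symm
        _ ≤ _ := by
            refine card_le_card_of_surjOn Subtype.val ?_
            intro q hq
            simp only [coe_filter, mem_univ, true_and, Set.mem_ofPred_eq] at hq
            obtain ⟨u, hu, huq⟩ := mem_edgeNeighbors.1 hq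
            obtain ⟨p, hp, rfl⟩ := mem_image.1 hu
            refine ⟨⟨q, (hA _ _ huq).1 p.2⟩, ?_, rfl⟩
            simp only [coe_filter, mem_univ, true_and, Set.mem_ofPred_eq]
            exact ⟨p, hp, huq⟩)
  have hcard : Fintype.card ι = Fintype.card κ := by
    rw [Fintype.card_subtype, Fintype.card_subtype, hX, hbal, ← hX]
    simp
  have hbij : f.Bijective := (Fintype.bijective_iff_injective_and_card f).2 ⟨hf, hcard⟩
  have key : (fun v => (y v : ℝ)) = ∑ p : ι, edgeVector s(p.1.1, (f p).1.1) := by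
    funext v
    have hne : ∀ p : ι, p.1.1 ≠ (f p).1.1 := fun p h => (f p).2 (h ▸ p.2)
    have hval : ∀ p : ι, edgeVector s(p.1.1, (f p).1.1) v =
        (if p.1.1 = v then 1 else 0) + (if (f p).1.1 = v then (1 : ℝ) else 0) := by
      intro p
      have := hne p
      by_cases h₁ : p.1.1 = v
      · rw [edgeVector_apply_of_mem (by simp [h₁]), if_pos h₁,
          if_neg fun h => this (h₁.trans h.symm), add_zero]
      · by_cases h₂ : (f p).1.1 = v
        · rw [edgeVector_apply_of_mem (by simp [h₂]), if_neg h₁, if_pos h₂, zero_add]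
        · rw [edgeVector_apply_of_notMem (by simp [Ne.symm h₁, Ne.symm h₂]), if_neg h₁, if_neg h₂,
            zero_add]
    rw [Finset.sum_apply, sum_congr rfl fun p _ => hval p, sum_add_distrib,
      hbij.sum_comp (fun q : κ => if q.1.1 = v then (1 : ℝ) else 0),
      Fintype.sum_subtype_add_sum_subtype (fun p : X => p.1 ∈ A)
        (fun p => if p.1 = v then (1 : ℝ) else 0), Fintype.sum_sigma,
      sum_eq_single v (fun w _ hw => sum_eq_zero fun _ _ => if_neg hw) (by simp)]
    simp
  rw [key]
  exact sum_mem fun p _ => edgeVector_mem_edgeCone (hr p)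

/-- Balance makes `x a - x b` an integer, so both ends have the same fractional part, and the floor
remains balanced. Hall's inequalities survive rounding because the error is less than 1. -/
theorem IsSide.floor_mem_coneLatticePoints (hA : IsSide E A) {a b : V} (hab : s(a, b) ∈ E)
    (ha : a ∈ A) {x : V → ℝ} (hx : x ∈ edgeCone E)
    (hint : ∀ v, v ∉ s(a, b) → Int.fract (x v) = 0) :
    (fun v => ⌊x v⌋) ∈ coneLatticePoints E ∧
      x = (fun v => (⌊x v⌋ : ℝ)) + Int.fract (x a) • edgeVector s(a, b) := by
  have hb : b ∈ Aᶜ := mem_compl.2 ((hA a b hab).1 ha)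
  have hnn := nonneg_of_mem_edgeCone hx
  have hfl : ∀ v, v ∉ s(a, b) → x v = ⌊x v⌋ := fun v hv => by
    linarith [Int.floor_add_fract (x v), hint v hv]
  have hA' : ∑ v ∈ A.erase a, x v = ((∑ v ∈ A.erase a, ⌊x v⌋ : ℤ) : ℝ) := by
    rw [Int.cast_sum]
    refine sum_congr rfl fun v hv => hfl v ?_
    rw [mem_erase] at hv
    rw [Sym2.mem_iff]
    rintro (rfl | rfl)
    exacts [hv.1 rfl, mem_compl.1 hb hv.2]
  have hB' : ∑ v ∈ Aᶜ.erase b, x v = ((∑ v ∈ Aᶜ.erase b, ⌊x v⌋ : ℤ) : ℝ) := by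
    rw [Int.cast_sum]
    refine sum_congr rfl fun v hv => hfl v ?_
    rw [mem_erase] at hv
    rw [Sym2.mem_iff]
    rintro (rfl | rfl)
    exacts [mem_compl.1 hv.2 ha, hv.1 rfl]
  have hbal := hA.sum_eq_sum_compl hx
  rw [← add_sum_erase _ _ ha, ← add_sum_erase _ _ hb, hA', hB'] at hbal
  have hfr : Int.fract (x b) = Int.fract (x a) := by
    have : x b = x a + ((∑ v ∈ A.erase a, ⌊x v⌋ - ∑ v ∈ Aᶜ.erase b, ⌊x v⌋ : ℤ) : ℝ) := by
      rw [Int.cast_sub]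
      linarith
    rw [this, Int.fract_add_intCast]
  have hdec : ∀ v, x v = ⌊x v⌋ + Int.fract (x a) * edgeVector s(a, b) v := by
    intro v
    by_cases hv : v ∈ s(a, b)
    · rw [edgeVector_apply_of_mem hv, mul_one]
      rcases Sym2.mem_iff.1 hv with rfl | rfl
      · exact (Int.floor_add_fract _).symm
      · rw [← hfr]
        exact (Int.floor_add_fract _).symm
    · rw [edgeVector_apply_of_notMem hv, mul_zero, add_zero]
      exact hfl v hv
  refine ⟨?_, funext hdec⟩
  have hcast : ∀ v, ((⌊x v⌋₊ : ℕ) : ℝ) = (⌊x v⌋ : ℝ) := fun v =>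
    natCast_floor_eq_intCast_floor (hnn v)
  have hmem := hA.natCast_mem_edgeCone (fun v => ⌊x v⌋₊) ?_ ?_
  · rw [coneLatticePoints, Set.mem_ofPred_eq]
    simpa only [hcast] using hmem
  · rw [← Nat.cast_inj (R := ℝ), Nat.cast_sum, Nat.cast_sum]
    simp only [hcast]
    rw [← add_sum_erase _ _ ha, ← add_sum_erase _ _ hb]
    push_cast at hbal
    linarith [Int.floor_add_fract (x a), Int.floor_add_fract (x b)]
  · intro S hS
    have hle := hA.sum_le_sum_edgeNeighbors hx hS
    rw [sum_congr rfl fun v _ => hdec v, sum_congr (s₁ := edgeNeighbors E S) rfl fun v _ => hdec v,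
      sum_add_distrib, sum_add_distrib, ← mul_sum, ← mul_sum] at hle
    have ht₀ := Int.fract_nonneg (x a)
    have ht₁ := Int.fract_lt_one (x a)
    have hnonneg : ∀ v, 0 ≤ edgeVector s(a, b) v :=
      fun v => nonneg_of_mem_edgeCone (edgeVector_mem_edgeCone hab) v
    -- Neighbors of `S` lie outside `A`, so only `b` can contribute.
    have hN : ∑ v ∈ edgeNeighbors E S, edgeVector s(a, b) v ≤ 1 := by
      calc _ ≤ ∑ v ∈ edgeNeighbors E S, if v = b then (1 : ℝ) else 0 := by
            refine sum_le_sum fun v hv => ?_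
            obtain ⟨u, hu, huv⟩ := mem_edgeNeighbors.1 hv
            have hva : v ≠ a := by
              rintro rfl
              exact (hA _ _ huv).1 (hS hu) ha
            split_ifs with h
            · rw [edgeVector_apply_of_mem (by simp [h])]
            · rw [edgeVector_apply_of_notMem (by simp [h, hva])]
        _ ≤ 1 := by
            rw [sum_ite_eq']
            split_ifs <;> norm_num
    suffices h : ∑ v ∈ S, ⌊x v⌋ ≤ ∑ v ∈ edgeNeighbors E S, ⌊x v⌋ by
      rw [← Nat.cast_le (α := ℝ), Nat.cast_sum, Nat.cast_sum]
      simp only [hcast]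
      exact_mod_cast h
    have hN' := mul_le_mul_of_nonneg_left hN ht₀
    by_cases haS : a ∈ S
    · have h1 : 1 ≤ ∑ v ∈ S, edgeVector s(a, b) v := by
        rw [← edgeVector_apply_of_mem (Sym2.mem_mk_left a b)]
        exact single_le_sum (fun v _ => hnonneg v) haS
      have h1' := mul_le_mul_of_nonneg_left h1 ht₀
      have : ∑ v ∈ S, (⌊x v⌋ : ℝ) ≤ ∑ v ∈ edgeNeighbors E S, (⌊x v⌋ : ℝ) := by linarith
      exact_mod_cast this
    -- For `a ∉ S` the inequality may lose the fractional part; this is below 1, so integrality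
    -- restores it.
    · have h1 := mul_nonneg ht₀ (sum_nonneg fun v (_ : v ∈ S) => hnonneg v)
      have : ∑ v ∈ S, (⌊x v⌋ : ℝ) < ∑ v ∈ edgeNeighbors E S, (⌊x v⌋ : ℝ) + 1 := by linarith
      exact Int.lt_add_one_iff.1 (by exact_mod_cast this)

end Bipartite

/-! ### Reduced points and unique decomposition. -/

section Gluing

variable {V : Type*} [Fintype V]

/-- The integral points of degree `m` of the cone over `E` from which the vector of `e` cannot be
subtracted within the cone. -/
def reducedConePoints (E : Set (Sym2 V)) (e : Sym2 V) (m : ℕ) : Set (V → ℤ) :=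
  {y ∈ conePointsOfDegree E m | y - intEdgeVector e ∉ coneLatticePoints E}

theorem finite_reducedConePoints (E : Set (Sym2 V)) (e : Sym2 V) (m : ℕ) :
    (reducedConePoints E e m).Finite :=
  (finite_conePointsOfDegree E m).subset fun _ h => h.1

theorem reducedConePoints_zero (E : Set (Sym2 V)) (e : Sym2 V) :
    reducedConePoints E e 0 = {0} := by
  rw [reducedConePoints, conePointsOfDegree_zero]
  ext y
  simp only [Set.mem_singleton_iff, Set.mem_ofPred_eq, and_iff_left_iff_imp]
  rintro rfl h
  induction e with | _ u v =>
  have := nonneg_of_mem_coneLatticePoints h u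
  rw [Pi.sub_apply, intEdgeVector_apply_of_mem (Sym2.mem_mk_left u v)] at this
  norm_num at this

/-- Translation by the vector of `e` maps degree `m` bijectively onto the non-reduced points of
degree `m + 1`. -/
theorem ncard_conePointsOfDegree_succ {E : Set (Sym2 V)} {e : Sym2 V} (he : e ∈ E)
    (hd : ¬ e.IsDiag) (m : ℕ) :
    (conePointsOfDegree E (m + 1)).ncard =
      (reducedConePoints E e (m + 1)).ncard + (conePointsOfDegree E m).ncard := by
  have hsum := sum_intEdgeVector hd
  have hun : conePointsOfDegree E (m + 1) =
      reducedConePoints E e (m + 1) ∪ (· + intEdgeVector e) '' conePointsOfDegree E m := by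
    ext y
    constructor
    · intro hy
      by_cases h : y - intEdgeVector e ∈ coneLatticePoints E
      · refine Or.inr ⟨_, ⟨h, ?_⟩, sub_add_cancel _ _⟩
        simp only [Pi.sub_apply, sum_sub_distrib, hsum, hy.2]
        push_cast
        ring
      · exact Or.inl ⟨hy, h⟩
    · rintro (hy | ⟨y, hy, rfl⟩)
      · exact hy.1
      · refine ⟨add_mem_coneLatticePoints hy.1 (intEdgeVector_mem_coneLatticePoints he), ?_⟩
        simp only [Pi.add_apply, sum_add_distrib, hsum, hy.2]
        push_cast
        ring
  rw [hun, Set.ncard_union_eq ?_ (finite_reducedConePoints _ _ _)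
    ((finite_conePointsOfDegree _ _).image _), Set.ncard_image_of_injective _ (add_left_injective _)]
  rw [Set.disjoint_left]
  rintro _ hy ⟨y, hy', rfl⟩
  exact hy.2 (by simpa using hy'.1)

variable {E₁ E₂ : Set (Sym2 V)}

section

variable [DecidableEq V] {A : Finset V} {a b : V}

theorem IsSide.sum_eq_two_mul (hA : IsSide E₂ A) {y : V → ℤ} (hy : y ∈ coneLatticePoints E₂) :
    ∑ v, y v = 2 * ∑ v ∈ A, y v := by
  have := hA.sum_eq_sum_compl hy
  have : ∑ v ∈ A, y v = ∑ v ∈ Aᶜ, y v := by exact_mod_cast this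
  rw [← sum_add_sum_compl A, ← this, two_mul]

theorem IsSide.exists_reduced_add (hA : IsSide E₂ A) (he₁ : s(a, b) ∈ E₁) (he₂ : s(a, b) ∈ E₂)
    (ha : a ∈ A) (hcommon : ∀ v, ∀ f ∈ E₁, ∀ g ∈ E₂, v ∈ f → v ∈ g → v ∈ s(a, b)) {z : V → ℤ}
    (hz : z ∈ coneLatticePoints (E₁ ∪ E₂)) :
    ∃ x ∈ coneLatticePoints E₁, ∃ y ∈ coneLatticePoints E₂,
      y - intEdgeVector s(a, b) ∉ coneLatticePoints E₂ ∧ x + y = z := by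
  have hex : ∃ y, y ∈ coneLatticePoints E₂ ∧ z - y ∈ coneLatticePoints E₁ := by
    rw [coneLatticePoints, Set.mem_ofPred_eq, edgeCone, Set.image_union, Submodule.span_union,
      Submodule.mem_sup] at hz
    obtain ⟨x, hx, y, hy, hxy⟩ := hz
    have hint : ∀ v, v ∉ s(a, b) → Int.fract (y v) = 0 := by
      intro v hv
      by_cases h : ∃ g ∈ E₂, v ∈ g
      · obtain ⟨g, hg, hvg⟩ := h
        have hx0 := apply_eq_zero_of_mem_edgeCone (show x ∈ edgeCone E₁ from hx) (v := v)
          fun f hf hvf => hv (hcommon v f hf g hg hvf hvg)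
        have := congrFun hxy v
        rw [Pi.add_apply, hx0, zero_add] at this
        rw [this, Int.fract_intCast]
      · push Not at h
        rw [apply_eq_zero_of_mem_edgeCone (show y ∈ edgeCone E₂ from hy) h, Int.fract_zero]
    obtain ⟨hmem, hdec⟩ := hA.floor_mem_coneLatticePoints he₂ ha hy hint
    refine ⟨_, hmem, ?_⟩
    have : (fun v => (((z - fun v => ⌊y v⌋) v : ℤ) : ℝ)) =
        x + Int.fract (y a) • edgeVector s(a, b) := by
      funext v
      have h₁ := congrFun hxy v
      have h₂ := congrFun hdec v
      simp only [Pi.add_apply, Pi.sub_apply, Int.cast_sub] at h₁ h₂ ⊢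
      linarith
    rw [coneLatticePoints, Set.mem_ofPred_eq, this]
    exact add_mem hx (smul_edgeVector_mem_edgeCone he₁ (Int.fract_nonneg _))
  -- Moving one copy of the edge vector from `y` to `z - y` lowers the sum of `y` by 2, so a minimal
  -- `y` is reduced.
  let S : Set (V → ℤ) := {y | y ∈ coneLatticePoints E₂ ∧ z - y ∈ coneLatticePoints E₁}
  obtain ⟨y, ⟨hy, hzy⟩, hmin⟩ := exists_minimalFor_of_wellFoundedLT (· ∈ S)
    (fun y => (∑ v, y v).toNat) hex
  refine ⟨z - y, hzy, y, hy, fun h => ?_, sub_add_cancel _ _⟩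
  have hsum := sum_intEdgeVector (hA.not_isDiag _ he₂)
  have hlt : ∑ v, (y - intEdgeVector s(a, b)) v = ∑ v, y v - 2 := by
    simp only [Pi.sub_apply, sum_sub_distrib, hsum]
  have hpos : 0 ≤ ∑ v, (y - intEdgeVector s(a, b)) v :=
    sum_nonneg fun v _ => nonneg_of_mem_coneLatticePoints h v
  have := hmin (j := y - intEdgeVector s(a, b)) ⟨h, by
    rw [sub_sub_eq_add_sub, add_sub_right_comm]
    exact add_mem_coneLatticePoints hzy (intEdgeVector_mem_coneLatticePoints he₁)⟩
    (by simp only; omega)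
  simp only at this
  omega

theorem IsSide.reduced_add_unique (hA : IsSide E₂ A) (he₂ : s(a, b) ∈ E₂) (ha : a ∈ A)
    (hcommon : ∀ v, ∀ f ∈ E₁, ∀ g ∈ E₂, v ∈ f → v ∈ g → v ∈ s(a, b)) {x x' y y' : V → ℤ}
    (hx : x ∈ coneLatticePoints E₁) (hx' : x' ∈ coneLatticePoints E₁)
    (hy : y ∈ coneLatticePoints E₂) (hy' : y' ∈ coneLatticePoints E₂)
    (hr : y - intEdgeVector s(a, b) ∉ coneLatticePoints E₂)
    (hr' : y' - intEdgeVector s(a, b) ∉ coneLatticePoints E₂) (h : x + y = x' + y') :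
    y = y' := by
  have hb : b ∈ Aᶜ := mem_compl.2 ((hA a b he₂).1 ha)
  have hzero : ∀ {E : Set (Sym2 V)} {x : V → ℤ}, x ∈ coneLatticePoints E → ∀ {v},
      (∀ f ∈ E, v ∉ f) → x v = 0 := fun {E x} hx {v} hv => by
    exact_mod_cast apply_eq_zero_of_mem_edgeCone (show _ ∈ edgeCone E from hx) hv
  have hoff : ∀ v, v ∉ s(a, b) → y v = y' v := by
    intro v hv
    by_cases hg : ∃ g ∈ E₂, v ∈ g
    · obtain ⟨g, hg, hvg⟩ := hg
      have hf : ∀ f ∈ E₁, v ∉ f := fun f hf hvf => hv (hcommon v f hf g hg hvf hvg)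
      have := congrFun h v
      rwa [Pi.add_apply, Pi.add_apply, hzero hx hf, hzero hx' hf, zero_add, zero_add] at this
    · push Not at hg
      rw [hzero hy hg, hzero hy' hg]
  have hbal : ∀ {y}, y ∈ coneLatticePoints E₂ →
      y a + ∑ v ∈ A.erase a, y v = y b + ∑ v ∈ Aᶜ.erase b, y v := fun {y} hy => by
    rw [add_sum_erase _ _ ha, add_sum_erase _ _ hb]
    exact_mod_cast hA.sum_eq_sum_compl hy
  have h₁ : ∑ v ∈ A.erase a, y v = ∑ v ∈ A.erase a, y' v := by
    refine sum_congr rfl fun v hv => hoff v ?_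
    rw [mem_erase] at hv
    rw [Sym2.mem_iff]
    rintro (rfl | rfl)
    exacts [hv.1 rfl, mem_compl.1 hb hv.2]
  have h₂ : ∑ v ∈ Aᶜ.erase b, y v = ∑ v ∈ Aᶜ.erase b, y' v := by
    refine sum_congr rfl fun v hv => hoff v ?_
    rw [mem_erase] at hv
    rw [Sym2.mem_iff]
    rintro (rfl | rfl)
    exacts [mem_compl.1 hv.2 ha, hv.1 rfl]
  have hdiff : ∀ {y y' : V → ℤ}, (∀ v, v ∉ s(a, b) → y v = y' v) → y a - y' a = y b - y' b →
      y' ∈ coneLatticePoints E₂ → y - intEdgeVector s(a, b) ∉ coneLatticePoints E₂ →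
      y a ≤ y' a := by
    intro y y' hoff hab hy' hr
    by_contra! hlt
    apply hr
    -- Here `y` is `y'` plus `y a - y' a ≥ 1` copies of the edge vector; removing one leaves a
    -- nonnegative number.
    have : y - intEdgeVector s(a, b) =
        y' + (y a - y' a - 1).toNat • intEdgeVector s(a, b) := by
      funext v
      by_cases hv : v ∈ s(a, b)
      · simp only [Pi.sub_apply, Pi.add_apply, Pi.smul_apply, intEdgeVector_apply_of_mem hv]
        rw [nsmul_eq_mul, mul_one]
        rcases Sym2.mem_iff.1 hv with rfl | rfl <;> omega
      · simp only [Pi.sub_apply, Pi.add_apply, Pi.smul_apply, intEdgeVector_apply_of_notMem hv,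
          smul_zero, sub_zero, add_zero, hoff v hv]
    rw [this]
    exact add_mem_coneLatticePoints hy' (nsmul_intEdgeVector_mem_coneLatticePoints he₂ _)
  have hba := hbal hy
  have hba' := hbal hy'
  have hle := hdiff hoff (by omega) hy' hr
  have hge := hdiff (fun v hv => (hoff v hv).symm) (by omega) hy hr'
  funext v
  by_cases hv : v ∈ s(a, b)
  · rcases Sym2.mem_iff.1 hv with rfl | rfl <;> omega
  · exact hoff v hv

theorem IsSide.ncard_conePointsOfDegree_union (hA : IsSide E₂ A) (he₁ : s(a, b) ∈ E₁)
    (he₂ : s(a, b) ∈ E₂) (ha : a ∈ A)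
    (hcommon : ∀ v, ∀ f ∈ E₁, ∀ g ∈ E₂, v ∈ f → v ∈ g → v ∈ s(a, b)) (m : ℕ) :
    (conePointsOfDegree (E₁ ∪ E₂) m).ncard =
      ∑ p ∈ antidiagonal m,
        (conePointsOfDegree E₁ p.1).ncard * (reducedConePoints E₂ s(a, b) p.2).ncard := by
  classical
  simp only [Set.ncard_eq_toFinset_card _ (finite_conePointsOfDegree _ _),
    Set.ncard_eq_toFinset_card _ (finite_reducedConePoints _ _ _), ← card_product]
  rw [← card_sigma]
  symm
  refine card_nbij (fun q => q.2.1 + q.2.2) ?_ ?_ ?_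
  · rintro ⟨⟨i, j⟩, x, y⟩ h
    simp only [coe_sigma, Set.mem_sigma_iff, mem_coe, HasAntidiagonal.mem_antidiagonal,
      mem_product, Set.Finite.mem_toFinset] at h ⊢
    obtain ⟨rfl, hx, hy⟩ := h
    refine ⟨add_mem_coneLatticePoints (coneLatticePoints_mono Set.subset_union_left hx.1)
      (coneLatticePoints_mono Set.subset_union_right hy.1.1), ?_⟩
    simp only [Pi.add_apply, sum_add_distrib, hx.2, hy.1.2]
    push_cast
    ring
  · rintro ⟨⟨i, j⟩, x, y⟩ h ⟨⟨i', j'⟩, x', y'⟩ h' hxy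
    simp only [coe_sigma, Set.mem_sigma_iff, mem_coe, HasAntidiagonal.mem_antidiagonal,
      mem_product, Set.Finite.mem_toFinset] at h h' hxy
    obtain ⟨-, hx, hy⟩ := h
    obtain ⟨-, hx', hy'⟩ := h'
    obtain rfl := hA.reduced_add_unique he₂ ha hcommon hx.1 hx'.1 hy.1.1 hy'.1.1 hy.2 hy'.2 hxy
    obtain rfl := add_right_cancel hxy
    obtain rfl : i = i' := by
      have := hx.2.symm.trans hx'.2
      omega
    obtain rfl : j = j' := by
      have := hy.1.2.symm.trans hy'.1.2
      omega
    rfl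
  · intro z hz
    simp only [Set.Finite.coe_toFinset] at hz
    obtain ⟨x, hx, y, hy, hr, rfl⟩ := hA.exists_reduced_add he₁ he₂ ha hcommon hz.1
    have hs := hz.2
    have hy₂ := hA.sum_eq_two_mul hy
    have hx₀ : 0 ≤ ∑ v, x v := sum_nonneg fun v _ => nonneg_of_mem_coneLatticePoints hx v
    have hy₀ : 0 ≤ ∑ v, y v := sum_nonneg fun v _ => nonneg_of_mem_coneLatticePoints hy v
    simp only [Pi.add_apply, sum_add_distrib] at hs
    -- By balance the degree of `y` is its sum over `A`. It is at most `m` because `x` has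
    -- nonnegative sum, so the subtraction does not truncate.
    refine ⟨⟨(m - (∑ v ∈ A, y v).toNat, (∑ v ∈ A, y v).toNat), x, y⟩, ?_, rfl⟩
    simp only [coe_sigma, Set.mem_sigma_iff, mem_coe, HasAntidiagonal.mem_antidiagonal,
      mem_product, Set.Finite.mem_toFinset]
    exact ⟨by omega, ⟨hx, by omega⟩, ⟨hy, by omega⟩, hr⟩

end

theorem mk_ncard_conePointsOfDegree_mul {E : Set (Sym2 V)} {e : Sym2 V} (he : e ∈ E)
    (hd : ¬ e.IsDiag) :
    PowerSeries.mk (fun m => ((conePointsOfDegree E m).ncard : ℤ)) * (1 - PowerSeries.X) =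
      PowerSeries.mk fun m => ((reducedConePoints E e m).ncard : ℤ) := by
  ext m
  rw [mul_sub, mul_one, map_sub]
  cases m with
  | zero => simp [conePointsOfDegree_zero, reducedConePoints_zero]
  | succ m =>
    simp only [PowerSeries.coeff_succ_mul_X, PowerSeries.coeff_mk]
    rw [ncard_conePointsOfDegree_succ he hd]
    push_cast
    ring

end Gluing

/-! ### From a 2-coloring to a side, and the factorization. -/

theorem exists_isSide_of_isBipartite {V : Type*} [Fintype V] {G : SimpleGraph V} {H : G.Subgraph}
    (h : H.coe.IsBipartite) : ∃ A : Finset V, IsSide H.edgeSet A := by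
  classical
  obtain ⟨c⟩ := h
  refine ⟨univ.filter fun v => ∃ hv : v ∈ H.verts, c ⟨v, hv⟩ = 0, fun u v huv => ?_⟩
  have hadj : H.Adj u v := huv
  have hne : c ⟨u, H.edge_vert hadj⟩ ≠ c ⟨v, H.edge_vert hadj.symm⟩ := c.valid hadj
  simp only [mem_filter, mem_univ, true_and, H.edge_vert hadj, H.edge_vert hadj.symm,
    exists_true_left]
  omega

end SimpleGraph

open SimpleGraph in
theorem theorem3p5 {V : Type*} [Finite V] (G : SimpleGraph V) (hG : G.Connected)
    (G₁ G₂ : G.Subgraph) (e : Sym2 V)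
    -- every edge of `G` lies in `G₁` or in `G₂`, and `e` is the only edge in both
    (hcover : ∀ f ∈ G.edgeSet, f ∈ G₁.edgeSet ∨ f ∈ G₂.edgeSet)
    (hedge : G₁.edgeSet ∩ G₂.edgeSet = {e})
    -- the subgraphs meet only in `e`: all their common vertices are end vertices of `e`
    (hvert : ∀ v ∈ G₁.verts ∩ G₂.verts, v ∈ e)
    -- `G₂` is bipartite
    (hbip : G₂.coe.IsBipartite)
    -- `e` lies on a cycle of `G₂`
    (hcycle : ∃ (w : V) (c : G.Walk w w), c.IsCycle ∧ c.toSubgraph ≤ G₂ ∧ e ∈ c.edges) :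
    G.ehrhartSeries =
      G₁.coe.ehrhartSeries * (G₂.coe.ehrhartSeries * (1 - PowerSeries.X)) := by
  classical
  have : Fintype V := Fintype.ofFinite V
  obtain ⟨he₁, he₂⟩ : e ∈ G₁.edgeSet ∩ G₂.edgeSet := hedge ▸ rfl
  have hun : G.edgeSet = G₁.edgeSet ∪ G₂.edgeSet :=
    Set.Subset.antisymm hcover (Set.union_subset G₁.edgeSet_subset G₂.edgeSet_subset)
  have hcommon : ∀ v, ∀ f ∈ G₁.edgeSet, ∀ g ∈ G₂.edgeSet, v ∈ f → v ∈ g → v ∈ e :=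
    fun v f hf g hg hvf hvg =>
      hvert v ⟨G₁.mem_verts_of_mem_edge hf hvf, G₂.mem_verts_of_mem_edge hg hvg⟩
  obtain ⟨A, hA⟩ := exists_isSide_of_isBipartite hbip
  obtain ⟨a, b, rfl, ha⟩ : ∃ a b, e = s(a, b) ∧ a ∈ A := by
    induction e with | _ a b =>
    by_cases ha : a ∈ A
    · exact ⟨a, b, rfl, ha⟩
    · exact ⟨b, a, Sym2.eq_swap, by_contra fun hb => ha ((hA a b he₂).2 hb)⟩
  rw [ehrhartSeries, ehrhartSeries, ehrhartSeries]
  simp only [ehrhartCount_coe_eq_ncard _ ⟨_, he₁⟩, ehrhartCount_coe_eq_ncard _ ⟨_, he₂⟩,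
    ehrhartCount_eq_ncard G ⟨_, G₁.edgeSet_subset he₁⟩]
  rw [mk_ncard_conePointsOfDegree_mul he₂ (hA.not_isDiag _ he₂)]
  ext m
  simp only [PowerSeries.coeff_mul, PowerSeries.coeff_mk, hun]
  rw [hA.ncard_conePointsOfDegree_union he₁ he₂ ha hcommon]
  push_cast
  rfl
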